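/- **Model (No-CD multiple-access channel).** $n$ anonymous devices run the same algorithm in synchronous rounds with a common start; each device has its own private infinite sequence of independent fair random bits. In each round a device is idle, listens, or transmits a message (a finite bit string). A listener receives the message $m$ if exactly one device transmits in the round, that message being $m$, and otherwise (no transmitter, or at least two) it hears silence; idle and transmitting devices receive no feedback. Every move is a (measurable) function of the device's random bits and of the feedback it has received so far. When a device stops, it identifies itself either as a leader or as a non-leader. The energy cost of a device is the number of rounds in which it transmits or listens. The number $n$ of devices is not known to the algorithm. **Theorem.** There is a universal constant $C>0$ such that for every real $0<f<1$ and every integer $\tilde n\ge 2$ there are an algorithm $\mathcal A$ in the No-CD model and a number $T$ of rounds (both depending only on $f$ and $\tilde n$) with the following properties. Write $L(f)=\max\{1,\log_2 (1/f)\}$; thus $L(f)=\log_2(1/f)$ for $f\le 1/2$. 1. (Time) $T\le C\cdot L(f)$ and, for every $n$ and all values of the random bits, every device stops after exactly $T$ rounds. 2. (Expected energy) For every $n$, the expected energy cost of each device is at most $C\,\tilde n^{-1}L(f)$. 3. (Worst-case energy) For every $n$ and all values of the random bits, the energy cost of each device is at most $C\,(1+\tilde n^{-1}\log_2(1/f))$.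 4. (Leader election) For every $n$ and all values of the random bits, at most one device identifies itself as a leader. If $\tilde n/2<n\le\tilde n$, then the probability that no device identifies itself as a leader is at most $f$. -/

import Mathlib

open MeasureTheory

namespace MultipleAccess

/-- Messages are finite bit strings of arbitrary length. -/
abbrev Message := List Bool

/-- The private randomness of one device: an infinite sequence of bits. -/
abbrev Tape := ℕ → Bool

/-- What a device does at the beginning of a round: one of the three actions of the channel model,
or stop for good, identifying itself as the leader (`true`) or as a non-leader (`false`). -/
inductive Move where
  | idle
  | listen
  | transmit (m : Message)
  | halt (leader : Bool)

/-- What a device learns from one round: nothing at all (it was idle or transmitted), or, if it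
listened, silence or a message. -/
inductive Feedback where
  | nothing
  | silence
  | message (m : Message)

/-- The message put on the channel, if any. -/
def Move.sent : Move → Option Message
  | .transmit m => some m
  | _ => none

/-- A round costs one unit of energy exactly if the device transmits or listens. -/
def Move.costsEnergy : Move → Bool
  | .transmit _ => true
  | .listen => true
  | _ => false

/-- What every listener hears, given the list of messages transmitted in the round (one entry per
transmitting device): without collision detection, a collision sounds like silence. -/
def heard : List Message → Feedback
  | [m] => .message m
  | _ => .silence

/-- A randomized algorithm for anonymous devices: the next move of a device is a function of its
private random bits and of the feedback from the previous rounds, the same function for every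
device. (Its own previous moves are determined by these data.) -/
structure Algorithm where
  move : Tape → List Feedback → Move
  measurable_move : ∀ (h : List Feedback) (a : Move), MeasurableSet {ω : Tape | move ω h = a}

namespace Algorithm

/-- The feedback that each of the `n` devices has collected before round `t` (rounds are numbered
`0, 1, 2, …`) in the No-CD model, if device `v` has the random bits `ω v`. The feedback of a device
that has halted never changes again, so such a device remains halted. -/
def history (A : Algorithm) {n : ℕ} (ω : Fin n → Tape) : ℕ → Fin n → List Feedback
  | 0 => fun _ => []
  | t + 1 => fun v =>
      let past := A.history ω t
      let moves : Fin n → Move := fun w => A.move (ω w) (past w)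
      match moves v with
      | .halt _ => past v
      | .idle => past v ++ [.nothing]
      | .transmit _ => past v ++ [.nothing]
      | .listen => past v ++ [heard ((List.ofFn moves).filterMap Move.sent)]

/-- The move of device `v` in round `t`. -/
def moveAt (A : Algorithm) {n : ℕ} (ω : Fin n → Tape) (t : ℕ) (v : Fin n) : Move :=
  A.move (ω v) (A.history ω t v)

/-- Device `v` has stopped before round `t`, that is, it takes part in at most `t` rounds. -/
def HaltedAt (A : Algorithm) {n : ℕ} (ω : Fin n → Tape) (t : ℕ) (v : Fin n) : Prop :=
  ∃ b : Bool, A.moveAt ω t v = .halt b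

/-- After `t` rounds, device `v` has stopped and identifies itself as a leader. -/
def IsLeader (A : Algorithm) {n : ℕ} (ω : Fin n → Tape) (t : ℕ) (v : Fin n) : Prop :=
  A.moveAt ω t v = .halt true

/-- The energy used by device `v` in the first `t` rounds. -/
def energy (A : Algorithm) {n : ℕ} (ω : Fin n → Tape) (t : ℕ) (v : Fin n) : ℕ :=
  ((Finset.range t).filter fun s => (A.moveAt ω s v).costsEnergy = true).card

end Algorithm

/-- The law of one sequence of independent fair bits. -/
noncomputable def tapeLaw : Measure Tape :=
  Measure.infinitePi fun _ : ℕ => (PMF.uniformOfFintype Bool).toMeasure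

/-- The joint law of the random bits of `n` devices: independent from device to device. -/
noncomputable def networkLaw (n : ℕ) : Measure (Fin n → Tape) :=
  Measure.pi fun _ : Fin n => tapeLaw

end MultipleAccess

namespace MultipleAccess

/-! Time is cut into `S = 16384 * l` slots of four rounds, with `l` of order `L(f)`. In each slot a
device is active with probability `2⁻ᵏ`, where `2ᵏ` is the least power of two at or above the
estimate, and is then candidate or witness by a fair coin. Without collision detection a lone
candidate cannot tell that it is alone, but an echo from a lone witness proves it. For the network
sizes at issue, such a pair occurs in each slot with probability at least `1 / 512`.

Electing the first successful candidate would require all devices to learn of it, which is too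
expensive. Instead each successful candidate takes the next `B = 4096` unassigned slots as its turn
to hold a token. A holder only broadcasts where the assigned slots end, and a new candidate reads
this off and appends its own interval. The intervals are disjoint, so at most one device holds slot
`S`, the slot just after the end; that device is the leader. Each success pushes the horizon by at
least `B`, so more than `4 * l` successes force a leader (`exists_relay_isLeader`). Energy is at
most a constant times the number of active slots (`relay_energy_le`), which gives the expected
bound.

For the worst-case bound each device stops being active after `c = O(1 + l / 2ᵏ)` active slots.
Single devices may well exceed `c`, but the total excess over all devices is rarely `4 * l` or more
(`sum_excess_le`), while there are rarely `8 * l` or fewer pairs (`sum_numPairs_le`). Both tails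
follow from exponential moments, which factor by independence over devices and slots respectively.
-/

/-! ### The channel and the feedback of a round. -/

/-- What a listener hears when the devices make the given moves. -/
def channel {n : ℕ} (moves : Fin n → Move) : Feedback :=
  heard ((List.ofFn moves).filterMap Move.sent)

/-- Whether the feedback is a message. -/
def Feedback.isMessage : Feedback → Bool
  | .message _ => true
  | _ => false

theorem heard_isMessage (l : List Message) : (heard l).isMessage = true ↔ l.length = 1 := by
  match l with
  | [] => simp [heard, Feedback.isMessage]
  | [m] => simp [heard, Feedback.isMessage]
  | a :: b :: l => simp [heard, Feedback.isMessage]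

theorem channel_isMessage {n : ℕ} (moves : Fin n → Move) :
    (channel moves).isMessage = true ↔ ∃! u, (moves u).sent.isSome = true := by
  have h : ((List.ofFn moves).filterMap Move.sent).length =
      (Finset.univ.filter fun u => (moves u).sent.isSome = true).card := by
    rw [List.length_filterMap_eq_countP, List.ofFn_eq_map, List.countP_map,
      List.countP_eq_length_filter]
    have hn : ((List.finRange n).filter
      ((fun a : Move => a.sent.isSome) ∘ moves)).Nodup := (List.nodup_finRange n).filter _
    rw [← List.toFinset_card_of_nodup hn]
    congr 1
    ext u
    simp
  rw [channel, heard_isMessage, h, Finset.card_eq_one]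
  constructor
  · rintro ⟨u, hu⟩
    have h' := fun v => Finset.ext_iff.1 hu v
    simp only [Finset.mem_filter, Finset.mem_univ, true_and, Finset.mem_singleton] at h'
    exact ⟨u, (h' u).2 rfl, fun v hv => (h' v).1 hv⟩
  · rintro ⟨u, hu, hv⟩
    refine ⟨u, ?_⟩
    ext v
    simp only [Finset.mem_filter, Finset.mem_univ, true_and, Finset.mem_singleton]
    exact ⟨hv v, fun e => e ▸ hu⟩

theorem heard_eq_message {l : List Message} {m : Message} (hl : (heard l).isMessage = true)
    (hm : m ∈ l) : heard l = .message m := by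
  rw [heard_isMessage, List.length_eq_one_iff] at hl
  obtain ⟨a, rfl⟩ := hl
  rw [List.mem_singleton.1 hm]
  rfl

theorem channel_eq_message {n : ℕ} (moves : Fin n → Move) (u : Fin n) (m : Message)
    (hu : (moves u).sent = some m) (hv : ∀ v, (moves v).sent.isSome = true → v = u) :
    channel moves = .message m := by
  refine heard_eq_message ((channel_isMessage moves).2 ⟨u, by simp [hu], hv⟩) ?_
  rw [List.mem_filterMap]
  exact ⟨moves u, by simp, hu⟩

theorem channel_eq_silence {n : ℕ} (moves : Fin n → Move)
    (h : (channel moves).isMessage = false) : channel moves = .silence := by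
  unfold channel at *
  generalize (List.ofFn moves).filterMap Move.sent = l at *
  match l with
  | [] => rfl
  | [m] => simp [heard, Feedback.isMessage] at h
  | a :: b :: l => rfl

/-- The feedback of a device that has not halted. -/
def feedback {n : ℕ} (moves : Fin n → Move) (v : Fin n) : Feedback :=
  match moves v with
  | .listen => channel moves
  | _ => .nothing

theorem Algorithm.history_succ (A : Algorithm) {n : ℕ} (ω : Fin n → Tape) (t : ℕ) (v : Fin n)
    (h : ∀ b, A.moveAt ω t v ≠ .halt b) :
    A.history ω (t + 1) v = A.history ω t v ++ [feedback (A.moveAt ω t) v] := by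
  have e : A.moveAt ω t v = A.move (ω v) (A.history ω t v) := rfl
  rw [Algorithm.history, feedback]
  simp only [e]
  rw [e] at h
  cases hm : A.move (ω v) (A.history ω t v) with
  | halt b => exact absurd hm (h b)
  | idle => rfl
  | transmit m => rfl
  | listen => rfl

theorem Algorithm.history_succ_of_halt (A : Algorithm) {n : ℕ} (ω : Fin n → Tape) (t : ℕ)
    (v : Fin n) (h : A.HaltedAt ω t v) : A.history ω (t + 1) v = A.history ω t v := by
  obtain ⟨b, hb⟩ := h
  have e : A.moveAt ω t v = A.move (ω v) (A.history ω t v) := rfl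
  rw [e] at hb
  rw [Algorithm.history]
  simp only [hb]

/-! ### The relay protocol. -/

/-- The role of a device in a slot: candidate (`some true`), witness (`some false`), or none. -/
abbrev Role := Option Bool

instance : MeasurableSpace Role := ⊤

instance : DiscreteMeasurableSpace Role := ⟨fun _ => trivial⟩

/-- The memory of a device during the relay protocol, which consists of slots of four rounds. A
device holds the token during the slots in `duty`; `horizon` is the first slot for which no token
holder has been determined, as far as the device knows. -/
structure RelayState where
  slot : ℕ
  phase : ℕ
  echo : Bool
  chosen : Bool
  duty : Finset ℕ
  horizon : ℕ

namespace RelayState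

/-- The memory at the start. -/
def init : RelayState := ⟨0, 0, false, false, ∅, 0⟩

/-- The move of a device. In the first two rounds of a slot, a unique candidate and a unique
witness find each other. In the last two rounds, the candidate learns the horizon from the
token holder and announces itself. -/
def act (ρ : ℕ → Role) (σ : RelayState) : Move :=
  match σ.phase with
  | 0 => match ρ σ.slot with
    | some true => .transmit []
    | some false => .listen
    | none => .idle
  | 1 => match ρ σ.slot with
    | some true => .listen
    | some false => if σ.echo = true then .transmit [] else .idle
    | none => .idle
  -- The horizon is sent in unary and read off as the length of the message. The holder of the next
  -- slot listens one slot ahead, so that it inherits an up-to-date horizon.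
  | 2 => if σ.slot ∈ σ.duty then .transmit (List.replicate σ.horizon true)
    else if σ.chosen = true ∨ σ.slot + 1 ∈ σ.duty then .listen else .idle
  | _ => if σ.chosen = true then .transmit []
    else if σ.slot ∈ σ.duty ∨ σ.slot + 1 ∈ σ.duty then .listen else .idle

/-- The new memory after a round; `B` is the number of slots for which a chosen candidate will
hold the token. -/
def update (B : ℕ) (σ : RelayState) (x : Feedback) : RelayState :=
  match σ.phase with
  | 0 => { σ with phase := 1, echo := x.isMessage }
  | 1 => { σ with phase := 2, chosen := x.isMessage }
  | 2 => { σ with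
      phase := 3
      horizon := match x with
        | .message m => m.length
        -- Silence means that the current slot has no holder, so the next slot is the first one that
        -- can still be assigned.
        | .silence => σ.slot + 1
        | .nothing => σ.horizon }
  | _ => { σ with
      slot := σ.slot + 1
      phase := 0
      duty := if σ.chosen = true then σ.duty ∪ Finset.Ico σ.horizon (σ.horizon + B) else σ.duty
      horizon := if σ.chosen = true ∨ x.isMessage = true then σ.horizon + B else σ.horizon }

/-- The memory after the given feedback. -/
def run (B : ℕ) (h : List Feedback) : RelayState := h.foldl (update B) init

theorem run_append (B : ℕ) (h : List Feedback) (x : Feedback) :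
    run B (h ++ [x]) = update B (run B h) x := by
  simp [run]

theorem act_ne_halt (ρ : ℕ → Role) (σ : RelayState) (b : Bool) : act ρ σ ≠ .halt b := by
  unfold act
  split
  · split <;> simp
  · split
    · simp
    · split_ifs <;> simp
    · simp
  · split_ifs <;> simp
  · split_ifs <;> simp

end RelayState

/-- The roles in all slots, if the roles in the first `S` slots are given. -/
def roleAt {S : ℕ} (r : Fin S → Role) (s : ℕ) : Role :=
  if hs : s < S then r ⟨s, hs⟩ else none

/-- The relay protocol with `S` slots, if the devices read their roles off their random bits by the
function `ρ`. -/
def relay (B S : ℕ) (ρ : Tape → Fin S → Role) (hρ : Measurable ρ) : Algorithm where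
  move ω h :=
    if h.length < 4 * S then
      RelayState.act (roleAt (ρ ω)) (RelayState.run B h)
    else .halt (decide (S ∈ (RelayState.run B h).duty))
  measurable_move h a :=
    hρ (MeasurableSet.of_discrete (s := {r : Fin S → Role |
      (if h.length < 4 * S then
        RelayState.act (roleAt r) (RelayState.run B h)
      else .halt (decide (S ∈ (RelayState.run B h).duty))) = a}))

/-! ### The ideal token schedule, and its simulation round by round. -/

section Schedule

variable {n : ℕ} (B : ℕ) (r : Fin n → ℕ → Role)

/-- Device `v` is the only candidate of slot `s`, and the slot has exactly one witness. -/
def Chosen (s : ℕ) (v : Fin n) : Prop :=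
  r v s = some true ∧ (∀ u, r u s = some true → u = v) ∧ ∃! w, r w s = some false

theorem Chosen.unique {r : Fin n → ℕ → Role} {s : ℕ} {u v : Fin n} (hu : Chosen r s u)
    (hv : Chosen r s v) : u = v :=
  hv.2.1 u hu.1

open Classical in
/-- The first slot for which no token holder is determined before slot `s`. -/
noncomputable def horizonAt : ℕ → ℕ
  | 0 => 0
  | s + 1 => if ∃ v, Chosen r s v then max (horizonAt s) (s + 1) + B else horizonAt s

open Classical in
/-- The slots for which device `v` knows before slot `s` that it holds the token. -/
noncomputable def dutyAt : ℕ → Fin n → Finset ℕ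
  | 0, _ => ∅
  | s + 1, v => if Chosen r s v then
      dutyAt s v ∪ Finset.Ico (max (horizonAt B r s) (s + 1)) (max (horizonAt B r s) (s + 1) + B)
      else dutyAt s v

theorem lt_horizonAt_of_mem_dutyAt {s t : ℕ} {v : Fin n} (h : t ∈ dutyAt B r s v) :
    t < horizonAt B r s := by
  induction s with
  | zero => simp [dutyAt] at h
  | succ s ih =>
    rw [dutyAt] at h
    rw [horizonAt]
    split_ifs at h with hc
    · rw [if_pos ⟨v, hc⟩]
      rcases Finset.mem_union.1 h with h | h
      · have := ih h
        omega
      · exact (Finset.mem_Ico.1 h).2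
    · have := ih h
      split_ifs <;> omega

/-- Each new interval starts at or beyond the current horizon, hence above every slot assigned
before. This disjointness makes the leader unique for all values of the random bits. -/
theorem eq_of_mem_dutyAt {s t : ℕ} {u v : Fin n} (hu : t ∈ dutyAt B r s u)
    (hv : t ∈ dutyAt B r s v) : u = v := by
  induction s with
  | zero => simp [dutyAt] at hu
  | succ s ih =>
    rw [dutyAt] at hu hv
    split_ifs at hu hv with h1 h2 h2
    · exact h1.unique h2
    · rcases Finset.mem_union.1 hu with h | h
      · exact ih h hv
      · have := lt_horizonAt_of_mem_dutyAt B r hv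
        have := (Finset.mem_Ico.1 h).1
        omega
    · rcases Finset.mem_union.1 hv with h | h
      · exact ih hu h
      · have := lt_horizonAt_of_mem_dutyAt B r hu
        have := (Finset.mem_Ico.1 h).1
        omega
    · exact ih hu hv

theorem dutyAt_subset_succ (s : ℕ) (v : Fin n) : dutyAt B r s v ⊆ dutyAt B r (s + 1) v := by
  rw [dutyAt]
  split_ifs
  · exact Finset.subset_union_left
  · exact subset_rfl

/-- A new interval starts at the horizon or, if that lies in the past, at the next slot. Only past
slots are ever skipped, which is why `s ≤ t` is needed. -/
theorem exists_mem_dutyAt {s t : ℕ} (hs : s ≤ t) (ht : t < horizonAt B r s) :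
    ∃ v, t ∈ dutyAt B r s v := by
  induction s with
  | zero => simp [horizonAt] at ht
  | succ s ih =>
    by_cases h : t < horizonAt B r s
    · obtain ⟨v, hv⟩ := ih (by omega) h
      exact ⟨v, dutyAt_subset_succ B r s v hv⟩
    · rw [horizonAt] at ht
      split_ifs at ht with hc
      · obtain ⟨v, hv⟩ := hc
        refine ⟨v, ?_⟩
        rw [dutyAt, if_pos hv]
        refine Finset.mem_union_right _ (Finset.mem_Ico.2 ⟨?_, ht⟩)
        omega
      · omega

open Classical in
theorem mul_card_chosen_le_horizonAt (s : ℕ) :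
    B * ((Finset.range s).filter fun i => ∃ v, Chosen r i v).card ≤ horizonAt B r s := by
  induction s with
  | zero => simp
  | succ s ih =>
    rw [Finset.range_add_one, Finset.filter_insert, horizonAt]
    split_ifs with h
    · rw [Finset.card_insert_of_notMem (by simp), mul_add]
      omega
    · exact ih

theorem card_dutyAt_le (s : ℕ) (v : Fin n) :
    (dutyAt B r s v).card ≤ B * ((Finset.range s).filter fun i => r v i ≠ none).card := by
  induction s with
  | zero => simp [dutyAt]
  | succ s ih =>
    rw [Finset.range_add_one, Finset.filter_insert, dutyAt]
    by_cases hc : Chosen r s v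
    · rw [if_pos hc, if_pos (by simp [hc.1]), Finset.card_insert_of_notMem (by simp), mul_add]
      refine (Finset.card_union_le _ _).trans ?_
      rw [Nat.card_Ico]
      omega
    · rw [if_neg hc]
      refine ih.trans (Nat.mul_le_mul_left _ (Finset.card_le_card ?_))
      split_ifs
      · exact Finset.subset_insert _ _
      · exact subset_rfl

/-- All devices perform one round of the relay protocol. -/
def relayStep (σ : Fin n → RelayState) : Fin n → RelayState := fun v =>
  (σ v).update B (feedback (fun w => (σ w).act (r w)) v)

/-- The memory before the first round of slot `s`. -/
def AtStart (s : ℕ) (σ : Fin n → RelayState) : Prop :=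
  ∀ v, (σ v).slot = s ∧ (σ v).phase = 0 ∧ (σ v).duty = dutyAt B r s v ∧
    (s ∈ dutyAt B r s v → (σ v).horizon = horizonAt B r s)

/-- The memory before the second round of slot `s`. -/
def AtEcho (s : ℕ) (σ : Fin n → RelayState) : Prop :=
  ∀ v, (σ v).slot = s ∧ (σ v).phase = 1 ∧ (σ v).duty = dutyAt B r s v ∧
    (s ∈ dutyAt B r s v → (σ v).horizon = horizonAt B r s) ∧
    (r v s = some false → ((σ v).echo = true ↔ ∃! u, r u s = some true))

/-- The memory before the third round of slot `s`. -/
def AtBeacon (s : ℕ) (σ : Fin n → RelayState) : Prop :=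
  ∀ v, (σ v).slot = s ∧ (σ v).phase = 2 ∧ (σ v).duty = dutyAt B r s v ∧
    (s ∈ dutyAt B r s v → (σ v).horizon = horizonAt B r s) ∧
    ((σ v).chosen = true ↔ Chosen r s v)

/-- The memory before the last round of slot `s`. -/
def AtJoin (s : ℕ) (σ : Fin n → RelayState) : Prop :=
  ∀ v, (σ v).slot = s ∧ (σ v).phase = 3 ∧ (σ v).duty = dutyAt B r s v ∧
    (s ∈ dutyAt B r s v ∨ s + 1 ∈ dutyAt B r s v ∨ Chosen r s v →
      (σ v).horizon = max (horizonAt B r s) (s + 1)) ∧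
    ((σ v).chosen = true ↔ Chosen r s v)

variable {B r} {s : ℕ} {σ : Fin n → RelayState}

theorem feedback_of_listen {moves : Fin n → Move} {v : Fin n} (h : moves v = .listen) :
    feedback moves v = channel moves := by
  simp [feedback, h]

theorem feedback_of_transmit {moves : Fin n → Move} {v : Fin n} {m : Message}
    (h : moves v = .transmit m) : feedback moves v = .nothing := by
  simp [feedback, h]

theorem feedback_of_idle {moves : Fin n → Move} {v : Fin n} (h : moves v = .idle) :
    feedback moves v = .nothing := by
  simp [feedback, h]

theorem AtStart.step (h : AtStart B r s σ) : AtEcho B r s (relayStep B r σ) := by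
  intro v
  obtain ⟨h1, h2, h3, h4⟩ := h v
  simp only [relayStep, RelayState.update, h2]
  refine ⟨h1, trivial, h3, h4, fun hv => ?_⟩
  have hact : ∀ w, (σ w).act (r w) = match r w s with
      | some true => .transmit []
      | some false => .listen
      | none => .idle := by
    intro w
    rcases hr : r w s with _ | _ | _ <;> simp only [RelayState.act, (h w).2.1, (h w).1, hr]
  rw [feedback_of_listen (by simp [hact, hv]), channel_isMessage]
  refine existsUnique_congr fun u => ?_
  rw [hact]
  rcases r u s with _ | _ | _ <;> simp [Move.sent]

/-- Witnesses echo exactly when the candidate is unique, and a candidate hears the echo exactly when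
in addition the witness is unique. -/
theorem AtEcho.step (h : AtEcho B r s σ) : AtBeacon B r s (relayStep B r σ) := by
  intro v
  obtain ⟨h1, h2, h3, h4, -⟩ := h v
  simp only [relayStep, RelayState.update, h2]
  refine ⟨h1, trivial, h3, h4, ?_⟩
  have hact : ∀ w, (σ w).act (r w) = match r w s with
      | some true => .listen
      | some false => if (σ w).echo = true then .transmit [] else .idle
      | none => .idle := by
    intro w
    rcases hr : r w s with _ | _ | _ <;> simp only [RelayState.act, (h w).2.1, (h w).1, hr]
  rcases hv : r v s with _ | _ | _
  · rw [feedback_of_idle (by simp [hact, hv])]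
    simp [Feedback.isMessage, Chosen, hv]
  · have : feedback (fun w => (σ w).act (r w)) v = .nothing := by
      by_cases he : (σ v).echo = true
      · exact feedback_of_transmit (m := []) (by simp [hact, hv, he])
      · exact feedback_of_idle (by simp [hact, hv, he])
    rw [this]
    simp [Feedback.isMessage, Chosen, hv]
  · rw [feedback_of_listen (by simp [hact, hv]), channel_isMessage]
    have key : ∀ u, ((σ u).act (r u)).sent.isSome = true ↔
        r u s = some false ∧ ∃! w, r w s = some true := by
      intro u
      rw [hact]
      rcases hu : r u s with _ | _ | _
      · simp [Move.sent]
      · rw [← (h u).2.2.2.2 hu]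
        by_cases he : (σ u).echo = true <;> simp [Move.sent, he]
      · simp [Move.sent]
    simp only [key]
    constructor
    · rintro ⟨w, ⟨hw, u, hu, hu'⟩, hw'⟩
      have huv := hu' v hv
      exact ⟨hv, fun x hx => (hu' x hx).trans huv.symm, w, hw,
        fun x hx => hw' x ⟨hx, u, hu, hu'⟩⟩
    · rintro ⟨-, hu, w, hw, hw'⟩
      exact ⟨w, ⟨hw, v, hv, hu⟩, fun x hx => hw' x hx.1⟩

/-- A slot has at most one holder, so the beacon never collides and silence really means that there
is no holder. In the first case the horizon exceeds `s`, in the second it does not; both are covered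
by the maximum with `s + 1`. -/
theorem AtBeacon.step (h : AtBeacon B r s σ) : AtJoin B r s (relayStep B r σ) := by
  intro v
  obtain ⟨h1, h2, h3, h4, h5⟩ := h v
  simp only [relayStep, RelayState.update, h2]
  refine ⟨h1, trivial, h3, fun hv => ?_, h5⟩
  have hact : ∀ w, (σ w).act (r w) =
      if s ∈ dutyAt B r s w then .transmit (List.replicate (σ w).horizon true)
      else if (σ w).chosen = true ∨ s + 1 ∈ dutyAt B r s w then .listen else .idle := by
    intro w
    simp only [RelayState.act, (h w).2.1, (h w).1, (h w).2.2.1]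
  have hsent : ∀ w, ((σ w).act (r w)).sent =
      if s ∈ dutyAt B r s w then some (List.replicate (horizonAt B r s) true) else none := by
    intro w
    rw [hact]
    split_ifs with hw
    · simp [Move.sent, (h w).2.2.2.1 hw]
    · simp [Move.sent]
    · simp [Move.sent]
  by_cases hd : s ∈ dutyAt B r s v
  · rw [feedback_of_transmit (m := List.replicate (σ v).horizon true) (by simp [hact, hd])]
    have := lt_horizonAt_of_mem_dutyAt B r hd
    simp only [h4 hd]
    omega
  · rw [feedback_of_listen (by rw [hact, if_neg hd, if_pos (by rw [h5]; tauto)])]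
    by_cases hs : s < horizonAt B r s
    · obtain ⟨u, hu⟩ := exists_mem_dutyAt B r le_rfl hs
      rw [channel_eq_message _ u (List.replicate (horizonAt B r s) true) (by simp [hsent, hu])]
      · simp only [List.length_replicate]
        omega
      · intro w hw
        rw [hsent] at hw
        split_ifs at hw with hw'
        · exact eq_of_mem_dutyAt B r hw' hu
        · simp at hw
    · rw [channel_eq_silence]
      · simp only
        omega
      · rw [Bool.eq_false_iff, Ne, channel_isMessage]
        rintro ⟨u, hu, -⟩
        simp only [hsent] at hu
        split_ifs at hu with hu'
        · exact hs (lt_horizonAt_of_mem_dutyAt B r hu')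
        · simp at hu

/-- The holder of slot `s + 1` is either the candidate just chosen, which knows its own interval, or
an earlier one, which has heard both the horizon and whether a newcomer extends it. At most one
candidate is chosen, so its announcement does not collide. -/
theorem AtJoin.step (h : AtJoin B r s σ) : AtStart B r (s + 1) (relayStep B r σ) := by
  intro v
  obtain ⟨h1, h2, h3, h4, h5⟩ := h v
  have hact : ∀ w, (σ w).act (r w) =
      if (σ w).chosen = true then .transmit []
      else if s ∈ dutyAt B r s w ∨ s + 1 ∈ dutyAt B r s w then .listen else .idle := by
    intro w
    simp only [RelayState.act, (h w).2.1, (h w).1, (h w).2.2.1]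
  simp only [relayStep, RelayState.update, h2, h1, h3, true_and]
  rw [dutyAt]
  by_cases hc : Chosen r s v
  · have hh := h4 (Or.inr (Or.inr hc))
    simp only [h5.2 hc, hc, if_true, true_or, hh, true_and]
    intro _
    rw [horizonAt, if_pos ⟨v, hc⟩]
  · simp only [mt h5.1 hc, hc, if_false, Bool.false_eq_true, false_or, true_and]
    intro hd
    have hh := h4 (Or.inr (Or.inl hd))
    rw [feedback_of_listen (by rw [hact, if_neg (mt h5.1 hc), if_pos (Or.inr hd)]), hh, horizonAt]
    have key : (channel fun w => (σ w).act (r w)).isMessage = true ↔ ∃ v, Chosen r s v := by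
      have hs : ∀ u, ((σ u).act (r u)).sent.isSome = true ↔ Chosen r s u := by
        intro u
        rw [hact, ← (h u).2.2.2.2]
        split_ifs <;> simp [Move.sent, *]
      rw [channel_isMessage]
      simp only [hs]
      exact ⟨fun ⟨u, hu, _⟩ => ⟨u, hu⟩, fun ⟨u, hu⟩ => ⟨u, hu, fun w hw => hw.unique hu⟩⟩
    have := lt_horizonAt_of_mem_dutyAt B r hd
    by_cases hk : ∃ v, Chosen r s v
    · rw [if_pos (key.2 hk), if_pos hk]
    · rw [if_neg (mt key.1 hk), if_neg hk]
      omega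

end Schedule

/-! ### Correctness and energy of the relay protocol. -/

section Relay

variable {B S : ℕ} {ρ : Tape → Fin S → Role} {hρ : Measurable ρ} {n : ℕ} (ω : Fin n → Tape)

theorem relay_move (x : Tape) (h : List Feedback) : (relay B S ρ hρ).move x h =
    if h.length < 4 * S then RelayState.act (roleAt (ρ x)) (RelayState.run B h)
    else .halt (decide (S ∈ (RelayState.run B h).duty)) :=
  rfl

theorem relay_length_history {t : ℕ} (ht : t ≤ 4 * S) (v : Fin n) :
    ((relay B S ρ hρ).history ω t v).length = t := by
  induction t with
  | zero => rfl
  | succ t ih =>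
    have hl := ih (by omega)
    rw [Algorithm.history_succ, List.length_append, hl]
    · rfl
    · intro b
      rw [Algorithm.moveAt, relay_move, if_pos (by omega)]
      exact RelayState.act_ne_halt _ _ b

theorem relay_moveAt {t : ℕ} (ht : t < 4 * S) (v : Fin n) : (relay B S ρ hρ).moveAt ω t v =
    RelayState.act (roleAt (ρ (ω v))) (RelayState.run B ((relay B S ρ hρ).history ω t v)) := by
  rw [Algorithm.moveAt, relay_move, relay_length_history ω ht.le, if_pos ht]

theorem relay_history_add (t : ℕ) (v : Fin n) :
    (relay B S ρ hρ).history ω (4 * S + t) v = (relay B S ρ hρ).history ω (4 * S) v := by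
  induction t with
  | zero => rfl
  | succ t ih =>
    rw [← add_assoc, Algorithm.history_succ_of_halt, ih]
    refine ⟨decide (S ∈ (RelayState.run B ((relay B S ρ hρ).history ω (4 * S) v)).duty), ?_⟩
    rw [Algorithm.moveAt, relay_move, ih, relay_length_history ω le_rfl, if_neg (lt_irrefl _)]

theorem relay_haltedAt (v : Fin n) (t : ℕ) :
    (relay B S ρ hρ).HaltedAt ω t v ↔ 4 * S ≤ t := by
  constructor
  · rintro ⟨b, hb⟩
    by_contra! ht
    rw [relay_moveAt ω ht] at hb
    exact RelayState.act_ne_halt _ _ b hb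
  · intro ht
    obtain ⟨d, rfl⟩ := Nat.exists_eq_add_of_le ht
    refine ⟨decide (S ∈ (RelayState.run B ((relay B S ρ hρ).history ω (4 * S) v)).duty), ?_⟩
    rw [Algorithm.moveAt, relay_move, relay_history_add, relay_length_history ω le_rfl,
      if_neg (lt_irrefl _)]

variable (ρ) in
/-- The roles of all devices, read off their random bits. -/
def roles (ω : Fin n → Tape) (v : Fin n) : ℕ → Role := roleAt (ρ (ω v))

variable (B ρ hρ) in
/-- The memories of all devices before round `t`. -/
def memory (t : ℕ) (v : Fin n) : RelayState :=
  RelayState.run B ((relay B S ρ hρ).history ω t v)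

theorem relay_memory_succ {t : ℕ} (ht : t < 4 * S) :
    memory B ρ hρ ω (t + 1) = relayStep B (roles ρ ω) (memory B ρ hρ ω t) := by
  ext1 v
  have hm : (relay B S ρ hρ).moveAt ω t =
      fun w => RelayState.act (roles ρ ω w) (memory B ρ hρ ω t w) :=
    funext fun w => relay_moveAt ω ht w
  rw [memory, Algorithm.history_succ, RelayState.run_append, hm]
  · rfl
  · intro b
    rw [relay_moveAt ω ht]
    exact RelayState.act_ne_halt _ _ b

theorem relay_atStart {s : ℕ} (hs : s ≤ S) :
    AtStart B (roles ρ ω) s (memory B ρ hρ ω (4 * s)) := by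
  induction s with
  | zero =>
    intro v
    exact ⟨rfl, rfl, rfl, fun h => absurd h (Finset.notMem_empty _)⟩
  | succ s ih =>
    have h := (ih (by omega)).step.step.step.step
    rwa [← relay_memory_succ ω (by omega), ← relay_memory_succ ω (by omega),
      ← relay_memory_succ ω (by omega), ← relay_memory_succ ω (by omega)] at h

theorem relay_isLeader (v : Fin n) :
    (relay B S ρ hρ).IsLeader ω (4 * S) v ↔ S ∈ dutyAt B (roles ρ ω) S v := by
  rw [Algorithm.IsLeader, Algorithm.moveAt, relay_move, relay_length_history ω le_rfl,
    if_neg (lt_irrefl _), ← ((relay_atStart (B := B) (hρ := hρ) ω le_rfl) v).2.2.1]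
  simp [memory]

theorem relay_isLeader_unique {v w : Fin n} (hv : (relay B S ρ hρ).IsLeader ω (4 * S) v)
    (hw : (relay B S ρ hρ).IsLeader ω (4 * S) w) : v = w :=
  eq_of_mem_dutyAt B _ ((relay_isLeader ω v).1 hv) ((relay_isLeader ω w).1 hw)

open Classical in
theorem exists_relay_isLeader
    (h : S < B * ((Finset.range S).filter fun s => ∃ v, Chosen (roles ρ ω) s v).card) :
    ∃ v, (relay B S ρ hρ).IsLeader ω (4 * S) v := by
  obtain ⟨v, hv⟩ := exists_mem_dutyAt B (roles ρ ω) le_rfl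
    (h.trans_le (mul_card_chosen_le_horizonAt B (roles ρ ω) S))
  exact ⟨v, (relay_isLeader ω v).2 hv⟩

/-- The cost of one round. -/
def Move.cost (a : Move) : ℕ := if a.costsEnergy = true then 1 else 0

theorem Move.cost_le_one (a : Move) : a.cost ≤ 1 := by
  unfold Move.cost
  split_ifs <;> simp

theorem Algorithm.energy_succ (A : Algorithm) (t : ℕ) (v : Fin n) :
    A.energy ω (t + 1) v = A.energy ω t v + (A.moveAt ω t v).cost := by
  rw [Algorithm.energy, Algorithm.energy, Finset.range_add_one, Finset.filter_insert, Move.cost]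
  split_ifs
  · rw [Finset.card_insert_of_notMem (by simp)]
  · rfl

/-- An active slot is charged all four rounds. An inactive device is awake only in the last two
rounds, and only if it holds the slot or the next one. The charges refer to the final duty set,
which contains all earlier ones. -/
theorem relay_energy_le_sum {s : ℕ} (hs : s ≤ S) (v : Fin n) :
    (relay B S ρ hρ).energy ω (4 * s) v ≤ ∑ i ∈ Finset.range s,
      (4 * (if roles ρ ω v i ≠ none then 1 else 0) +
        2 * (if i ∈ dutyAt B (roles ρ ω) S v then 1 else 0) +
        2 * (if i + 1 ∈ dutyAt B (roles ρ ω) S v then 1 else 0)) := by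
  induction s with
  | zero => simp [Algorithm.energy]
  | succ s ih =>
    rw [Finset.sum_range_succ]
    have h0 := relay_atStart (B := B) (hρ := hρ) ω (show s ≤ S by omega)
    have h1 := h0.step
    have h2 := h1.step
    have h3 := h2.step
    rw [← relay_memory_succ ω (by omega)] at h1 h2 h3
    rw [← relay_memory_succ ω (by omega)] at h2 h3
    rw [← relay_memory_succ ω (by omega)] at h3
    have hd : dutyAt B (roles ρ ω) s v ⊆ dutyAt B (roles ρ ω) S v :=
      monotone_nat_of_le_succ (fun i => dutyAt_subset_succ B (roles ρ ω) i v) (by omega)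
    have hm : ∀ t < 4 * S, (relay B S ρ hρ).moveAt ω t v =
        RelayState.act (roles ρ ω v) (memory B ρ hρ ω t v) := fun t ht => relay_moveAt ω ht v
    have e0 : ((relay B S ρ hρ).moveAt ω (4 * s) v).cost ≤
        if roles ρ ω v s ≠ none then 1 else 0 := by
      split_ifs with hr
      · exact Move.cost_le_one _
      · rw [hm _ (by omega), RelayState.act, (h0 v).2.1, (h0 v).1]
        rw [not_not] at hr
        simp [hr, Move.cost, Move.costsEnergy]
    have e1 : ((relay B S ρ hρ).moveAt ω (4 * s + 1) v).cost ≤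
        if roles ρ ω v s ≠ none then 1 else 0 := by
      split_ifs with hr
      · exact Move.cost_le_one _
      · rw [hm _ (by omega), RelayState.act, (h1 v).2.1, (h1 v).1]
        rw [not_not] at hr
        simp [hr, Move.cost, Move.costsEnergy]
    have hc : ¬ roles ρ ω v s ≠ none → ¬ Chosen (roles ρ ω) s v := by
      intro h hc
      exact h (by simp [hc.1])
    have hcost : ∀ a : Move, (¬ roles ρ ω v s ≠ none → s ∉ dutyAt B (roles ρ ω) S v →
        s + 1 ∉ dutyAt B (roles ρ ω) S v → a = .idle) → a.cost ≤
        (if roles ρ ω v s ≠ none then 1 else 0) +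
        (if s ∈ dutyAt B (roles ρ ω) S v then 1 else 0) +
        (if s + 1 ∈ dutyAt B (roles ρ ω) S v then 1 else 0) := by
      intro a ha
      have := Move.cost_le_one a
      split_ifs with k1 k2 k3 k3 k2 k3 k3 <;> try omega
      rw [ha k1 k2 k3]
      simp [Move.cost, Move.costsEnergy]
    have e2 := hcost ((relay B S ρ hρ).moveAt ω (4 * s + 1 + 1) v) fun k1 k2 k3 => by
      have c1 : (memory B ρ hρ ω (4 * s + 1 + 1) v).chosen = false := by
        rw [Bool.eq_false_iff, Ne, (h2 v).2.2.2.2]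
        exact hc k1
      rw [hm _ (by omega), RelayState.act, (h2 v).2.1, (h2 v).1, (h2 v).2.2.1, c1]
      simp [mt (@hd s) k2, mt (@hd (s + 1)) k3]
    have e3 := hcost ((relay B S ρ hρ).moveAt ω (4 * s + 1 + 1 + 1) v) fun k1 k2 k3 => by
      have c1 : (memory B ρ hρ ω (4 * s + 1 + 1 + 1) v).chosen = false := by
        rw [Bool.eq_false_iff, Ne, (h3 v).2.2.2.2]
        exact hc k1
      rw [hm _ (by omega), RelayState.act, (h3 v).2.1, (h3 v).1, (h3 v).2.2.1, c1]
      simp [mt (@hd s) k2, mt (@hd (s + 1)) k3]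
    have e4 : (relay B S ρ hρ).energy ω (4 * (s + 1)) v =
        (relay B S ρ hρ).energy ω (4 * s) v + ((relay B S ρ hρ).moveAt ω (4 * s) v).cost +
        ((relay B S ρ hρ).moveAt ω (4 * s + 1) v).cost +
        ((relay B S ρ hρ).moveAt ω (4 * s + 1 + 1) v).cost +
        ((relay B S ρ hρ).moveAt ω (4 * s + 1 + 1 + 1) v).cost := by
      rw [← Algorithm.energy_succ, ← Algorithm.energy_succ, ← Algorithm.energy_succ,
        ← Algorithm.energy_succ]
      rfl
    have := ih (by omega)
    omega

theorem relay_energy_le (v : Fin n) : (relay B S ρ hρ).energy ω (4 * S) v ≤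
    (4 + 4 * B) * (Finset.univ.filter fun s : Fin S => ρ (ω v) s ≠ none).card := by
  have h1 : ((Finset.range S).filter fun i => roles ρ ω v i ≠ none).card =
      (Finset.univ.filter fun s : Fin S => ρ (ω v) s ≠ none).card := by
    rw [Finset.card_filter, Finset.card_filter, Finset.sum_range]
    refine Finset.sum_congr rfl fun i _ => ?_
    simp [roles, roleAt]
  have h2 : ∑ i ∈ Finset.range S, (if i ∈ dutyAt B (roles ρ ω) S v then 1 else 0) ≤
      (dutyAt B (roles ρ ω) S v).card := by
    rw [← Finset.card_filter]
    exact Finset.card_le_card fun i hi => (Finset.mem_filter.1 hi).2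
  have h3 : ∑ i ∈ Finset.range S, (if i + 1 ∈ dutyAt B (roles ρ ω) S v then 1 else 0) ≤
      (dutyAt B (roles ρ ω) S v).card := by
    rw [← Finset.card_filter]
    -- The slots just before a duty slot inject into the duty set by the successor map.
    exact Finset.card_le_card_of_injOn (· + 1) (fun i hi => (Finset.mem_filter.1 hi).2)
      (fun i _ j _ h => Nat.succ_injective h)
  have h4 := card_dutyAt_le B (roles ρ ω) S v
  refine (relay_energy_le_sum ω le_rfl v).trans ?_
  rw [Finset.sum_add_distrib, Finset.sum_add_distrib, ← Finset.mul_sum, ← Finset.mul_sum,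
    ← Finset.mul_sum, ← Finset.card_filter, h1, add_mul, mul_assoc]
  rw [h1] at h4
  omega

end Relay

/-! ### The law of the roles read off the random bits. -/

instance : IsProbabilityMeasure tapeLaw := by
  unfold tapeLaw
  infer_instance

instance (n : ℕ) : IsProbabilityMeasure (networkLaw n) := by
  unfold networkLaw
  infer_instance

/-- The `s`-th of infinitely many disjoint infinite subsequences of a sequence of bits. -/
def subtape (ω : Tape) (s : ℕ) : Tape := fun j => ω (Nat.pair s j)

theorem measurable_subtape : Measurable subtape := by
  unfold subtape
  fun_prop

/-- The pairing function is injective, so it reindexes the fair bits into an independent family over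
pairs; currying this family gives independent tapes. -/
theorem tapeLaw_map_subtape :
    tapeLaw.map subtape = Measure.infinitePi fun _ : ℕ => tapeLaw := by
  have h1 := Measure.infinitePi_map_curry
    (fun (_ : ℕ) (_ : ℕ) => (PMF.uniformOfFintype Bool).toMeasure)
  have h2 := Measure.map_infinitePi_infinitePi_of_inj
    (P := fun _ : ℕ => (PMF.uniformOfFintype Bool).toMeasure) (f := fun p : ℕ × ℕ => Nat.pair p.1 p.2)
    (fun p p' h => Prod.ext (Nat.pair_eq_pair.1 h).1 (Nat.pair_eq_pair.1 h).2)
  rw [← h2, Measure.map_map (by fun_prop) (by fun_prop)] at h1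
  exact h1

/-- The role determined by a sequence of bits: with probability `1 / 2 ^ k` the device is active,
and then candidate or witness with equal probability. -/
def roleOfBits (k : ℕ) (x : Tape) : Role :=
  if ∀ i < k, x i = true then some (x k) else none

theorem measurable_roleOfBits (k : ℕ) : Measurable (roleOfBits k) := by
  have : roleOfBits k = (fun b : Fin (k + 1) → Bool =>
      if ∀ i : Fin k, b i.castSucc = true then some (b (Fin.last k)) else none) ∘
      fun (x : Tape) (i : Fin (k + 1)) => x i := by
    ext1 x
    simp only [roleOfBits, Function.comp_apply, Fin.val_last, Fin.val_castSucc]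
    congr 1
    exact propext ⟨fun h i => h i i.2, fun h i hi => h ⟨i, hi⟩⟩
  rw [this]
  exact (Measurable.of_discrete).comp (by fun_prop)

/-- The probability of a role. -/
noncomputable def roleWeight (k : ℕ) : Role → ℝ
  | none => 1 - (1 / 2) ^ k
  | some _ => (1 / 2) ^ k / 2

theorem roleWeight_nonneg (k : ℕ) (a : Role) : 0 ≤ roleWeight k a := by
  cases a with
  | none => exact sub_nonneg.2 (pow_le_one₀ (by norm_num) (by norm_num))
  | some b => unfold roleWeight; positivity

theorem sum_roleWeight (k : ℕ) : ∑ a, roleWeight k a = 1 := by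
  simp only [Fintype.sum_option, Fintype.sum_bool, roleWeight]
  ring

theorem uniformBool_apply (b : Bool) :
    (PMF.uniformOfFintype Bool).toMeasure {b} = ENNReal.ofReal (1 / 2) := by
  rw [PMF.toMeasure_apply_singleton _ _ (by measurability)]
  simp [PMF.uniformOfFintype_apply, ENNReal.ofReal_inv_of_pos]

theorem tapeLaw_forall_lt (k : ℕ) :
    tapeLaw {x | ∀ i < k, x i = true} = ENNReal.ofReal ((1 / 2) ^ k) := by
  have : {x : Tape | ∀ i < k, x i = true} =
      Set.pi (Finset.range k) fun _ => {true} := by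
    ext x
    simp
  rw [this, tapeLaw, Measure.infinitePi_pi _ (fun _ _ => by measurability)]
  simp only [uniformBool_apply, Finset.prod_const, Finset.card_range]
  rw [ENNReal.ofReal_pow (by norm_num)]

theorem tapeLaw_roleOfBits_ne_none (k : ℕ) :
    tapeLaw {x | roleOfBits k x ≠ none} = ENNReal.ofReal ((1 / 2) ^ k) := by
  rw [← tapeLaw_forall_lt]
  congr 1
  ext x
  simp [roleOfBits]

theorem tapeLaw_roleOfBits (k : ℕ) (a : Role) :
    tapeLaw {x | roleOfBits k x = a} = ENNReal.ofReal (roleWeight k a) := by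
  cases a with
  | none =>
    have h : {x | roleOfBits k x = none} = {x | roleOfBits k x ≠ none}ᶜ := by
      ext x
      simp
    rw [h, prob_compl_eq_one_sub, tapeLaw_roleOfBits_ne_none, roleWeight,
      ENNReal.ofReal_sub _ (by positivity), ENNReal.ofReal_one]
    exact (measurable_roleOfBits k) (MeasurableSet.of_discrete (s := {a | a ≠ none}))
  | some b =>
    have : {x : Tape | roleOfBits k x = some b} =
        Set.pi (Finset.range (k + 1)) fun i => {if i = k then b else true} := by
      ext x
      simp only [roleOfBits, Set.mem_ofPred_eq, Set.mem_pi, Finset.coe_range, Set.mem_Iio,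
        Set.mem_singleton_iff, Nat.lt_succ_iff_lt_or_eq]
      constructor
      · intro h i hi
        split_ifs at h with h1
        rcases hi with hi | hi
        · rw [if_neg hi.ne, h1 i hi]
        · rw [if_pos hi, hi]
          simpa using h
      · intro h
        rw [if_pos (fun i hi => by rw [h i (Or.inl hi), if_neg hi.ne]), h k (Or.inr rfl), if_pos rfl]
    rw [this, tapeLaw, Measure.infinitePi_pi _ (fun _ _ => by measurability)]
    simp only [uniformBool_apply, Finset.prod_const, Finset.card_range]
    rw [← ENNReal.ofReal_pow (by norm_num), roleWeight, pow_succ]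
    congr 1
    ring

/-- The roles in the first `S` slots determined by the bits of a device. -/
def rawRoles (k S : ℕ) (ω : Tape) (s : Fin S) : Role := roleOfBits k (subtape ω s)

theorem measurable_rawRoles (k S : ℕ) : Measurable (rawRoles k S) := by
  refine measurable_pi_lambda _ fun s => (measurable_roleOfBits k).comp ?_
  exact (measurable_pi_apply (s : ℕ)).comp measurable_subtape

theorem tapeLaw_rawRoles_eq (k : ℕ) {S : ℕ} (y : Fin S → Role) :
    tapeLaw {ω | rawRoles k S ω = y} = ENNReal.ofReal (∏ s, roleWeight k (y s)) := by
  have h : {ω | rawRoles k S ω = y} = subtape ⁻¹' (Set.pi (Finset.range S)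
      fun s => {x | ∀ hs : s < S, roleOfBits k x = y ⟨s, hs⟩}) := by
    ext ω
    simp only [Set.mem_ofPred_eq, Set.mem_preimage, Set.mem_pi, Finset.coe_range, Set.mem_Iio,
      funext_iff, rawRoles]
    exact ⟨fun h s _ hs => h ⟨s, hs⟩, fun h s => h s s.2 s.2⟩
  have hm : ∀ s, MeasurableSet {x | ∀ hs : s < S, roleOfBits k x = y ⟨s, hs⟩} := fun s =>
    measurable_roleOfBits k (MeasurableSet.of_discrete (s := {a | ∀ hs : s < S, a = y ⟨s, hs⟩}))
  rw [h, ← Measure.map_apply measurable_subtape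
    (MeasurableSet.pi (Finset.countable_toSet _) fun s _ => hm s), tapeLaw_map_subtape,
    Measure.infinitePi_pi _ (fun s _ => hm s), Finset.prod_range,
    ENNReal.ofReal_prod_of_nonneg fun _ _ => roleWeight_nonneg _ _]
  refine Finset.prod_congr rfl fun s _ => ?_
  rw [← tapeLaw_roleOfBits]
  simp

theorem tapeLaw_rawRoles_ne_none (k : ℕ) {S : ℕ} (s : Fin S) :
    tapeLaw {ω | rawRoles k S ω s ≠ none} = ENNReal.ofReal ((1 / 2) ^ k) := by
  have hm : MeasurableSet {x | roleOfBits k x ≠ none} :=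
    measurable_roleOfBits k (MeasurableSet.of_discrete (s := {a | a ≠ none}))
  have h : {ω | rawRoles k S ω s ≠ none} =
      subtape ⁻¹' (Function.eval (s : ℕ) ⁻¹' {x | roleOfBits k x ≠ none}) := rfl
  rw [h, ← Measure.map_apply measurable_subtape (measurable_pi_apply _ hm), tapeLaw_map_subtape,
    (measurePreserving_eval_infinitePi (fun _ : ℕ => tapeLaw) (s : ℕ)).measure_preimage
      hm.nullMeasurableSet, tapeLaw_roleOfBits_ne_none]

/-- The probability that the devices have given roles. -/
noncomputable def tableWeight (k : ℕ) {n S : ℕ} (x : Fin n → Fin S → Role) : ℝ :=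
  ∏ v, ∏ s, roleWeight k (x v s)

theorem tableWeight_nonneg (k : ℕ) {n S : ℕ} (x : Fin n → Fin S → Role) : 0 ≤ tableWeight k x :=
  Finset.prod_nonneg fun _ _ => Finset.prod_nonneg fun _ _ => roleWeight_nonneg _ _

theorem networkLaw_rawRoles_eq (k : ℕ) {n S : ℕ} (x : Fin n → Fin S → Role) :
    networkLaw n {ω | (fun v => rawRoles k S (ω v)) = x} = ENNReal.ofReal (tableWeight k x) := by
  have h : {ω : Fin n → Tape | (fun v => rawRoles k S (ω v)) = x} =
      Set.pi Set.univ fun v => {ω | rawRoles k S ω = x v} := by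
    ext ω
    simp [funext_iff]
  rw [h, networkLaw, Measure.pi_pi, tableWeight, ENNReal.ofReal_prod_of_nonneg
    fun _ _ => Finset.prod_nonneg fun _ _ => roleWeight_nonneg _ _]
  exact Finset.prod_congr rfl fun v _ => tapeLaw_rawRoles_eq k (x v)

/-- This reduces probabilities to finite weighted sums over role tables. -/
theorem networkLaw_rawRoles_mem_le (k : ℕ) {n S : ℕ} (A : Finset (Fin n → Fin S → Role)) :
    networkLaw n {ω | (fun v => rawRoles k S (ω v)) ∈ A} ≤
      ENNReal.ofReal (∑ x ∈ A, tableWeight k x) := by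
  have h : {ω : Fin n → Tape | (fun v => rawRoles k S (ω v)) ∈ A} =
      ⋃ x ∈ A, {ω | (fun v => rawRoles k S (ω v)) = x} := by
    ext ω
    simp
  rw [h, ENNReal.ofReal_sum_of_nonneg fun _ _ => tableWeight_nonneg _ _]
  refine (measure_biUnion_finset_le _ _).trans (Finset.sum_le_sum fun x _ => ?_)
  rw [networkLaw_rawRoles_eq]

theorem lintegral_card_active (k S : ℕ) {n : ℕ} (v : Fin n) :
    ∫⁻ ω, ((Finset.univ.filter fun s : Fin S => rawRoles k S (ω v) s ≠ none).card : ENNReal)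
      ∂(networkLaw n) = ENNReal.ofReal (S * (1 / 2) ^ k) := by
  have hm : ∀ s : Fin S, MeasurableSet {x | rawRoles k S x s ≠ none} := fun s =>
    measurable_rawRoles k S
      (MeasurableSet.of_discrete (s := {a : Fin S → Role | a s ≠ none}))
  have hm' : ∀ s : Fin S, MeasurableSet {ω : Fin n → Tape | rawRoles k S (ω v) s ≠ none} :=
    fun s => (measurable_pi_apply (X := fun _ : Fin n => Tape) v) (hm s)
  have h : ∀ ω : Fin n → Tape,
      ((Finset.univ.filter fun s : Fin S => rawRoles k S (ω v) s ≠ none).card : ENNReal) =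
      ∑ s : Fin S, Set.indicator {ω : Fin n → Tape | rawRoles k S (ω v) s ≠ none} 1 ω := by
    intro ω
    rw [Finset.card_filter, Nat.cast_sum]
    refine Finset.sum_congr rfl fun s _ => ?_
    by_cases hs : rawRoles k S (ω v) s = none <;> simp [Set.indicator, hs]
  simp only [h]
  rw [lintegral_finsetSum _ fun s _ => measurable_one.indicator (hm' s)]
  have h1 : ∀ s : Fin S,
      ∫⁻ ω, Set.indicator {ω : Fin n → Tape | rawRoles k S (ω v) s ≠ none} 1 ω ∂(networkLaw n) =
        ENNReal.ofReal ((1 / 2) ^ k) := by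
    intro s
    rw [lintegral_indicator_one (hm' s), ← tapeLaw_rawRoles_ne_none k s]
    exact (measurePreserving_eval (fun _ : Fin n => tapeLaw) v).measure_preimage
      (hm s).nullMeasurableSet
  simp only [h1, Finset.sum_const, Finset.card_univ, Fintype.card_fin]
  rw [ENNReal.ofReal_mul (by positivity), ENNReal.ofReal_natCast, nsmul_eq_mul]

/-! ### Capping the number of active slots of a device. -/

section Truncate

variable {S : ℕ}

/-- The slots in which a device is active. -/
def active (y : Fin S → Role) : Finset (Fin S) := Finset.univ.filter fun s => y s ≠ none

theorem mem_active {y : Fin S → Role} {s : Fin S} : s ∈ active y ↔ y s ≠ none := by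
  simp [active]

/-- The number of earlier slots in which a device is active. -/
def activeBefore (y : Fin S → Role) (s : Fin S) : ℕ := ((active y).filter fun i => i < s).card

/-- A device that is active in the first `c` of its active slots only. -/
def truncate (c : ℕ) (y : Fin S → Role) (s : Fin S) : Role :=
  if activeBefore y s < c then y s else none

theorem activeBefore_lt_of_lt {y : Fin S → Role} {s t : Fin S} (hs : s ∈ active y) (h : s < t) :
    activeBefore y s < activeBefore y t := by
  refine Finset.card_lt_card (Finset.ssubset_iff_of_subset ?_ |>.2 ⟨s, ?_, ?_⟩)
  · intro i hi
    rw [Finset.mem_filter] at hi ⊢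
    exact ⟨hi.1, hi.2.trans h⟩
  · exact Finset.mem_filter.2 ⟨hs, h⟩
  · simp

theorem activeBefore_injOn (y : Fin S → Role) :
    Set.InjOn (activeBefore y) (active y : Set (Fin S)) := by
  intro s hs t ht h
  by_contra hst
  rcases lt_or_gt_of_ne hst with h1 | h1
  · exact (activeBefore_lt_of_lt hs h1).ne h
  · exact (activeBefore_lt_of_lt ht h1).ne' h

theorem activeBefore_lt_card {y : Fin S → Role} {s : Fin S} (hs : s ∈ active y) :
    activeBefore y s < (active y).card := by
  refine Finset.card_lt_card (Finset.ssubset_iff_of_subset (Finset.filter_subset _ _) |>.2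
    ⟨s, hs, by simp⟩)

theorem active_truncate_subset (c : ℕ) (y : Fin S → Role) : active (truncate c y) ⊆ active y := by
  intro s
  rw [mem_active, mem_active, truncate]
  split_ifs <;> simp

theorem card_active_truncate_le (c : ℕ) (y : Fin S → Role) :
    (active (truncate c y)).card ≤ c := by
  refine (Finset.card_le_card_of_injOn (t := Finset.range c) (activeBefore y) (fun s hs => ?_)
    ((activeBefore_injOn y).mono (active_truncate_subset c y))).trans_eq (Finset.card_range c)
  rw [Finset.mem_coe, mem_active, truncate] at hs
  split_ifs at hs with h
  · simpa using h
  · simp at hs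

theorem card_truncate_ne_le (c : ℕ) (y : Fin S → Role) :
    (Finset.univ.filter fun s => truncate c y s ≠ y s).card ≤ (active y).card - c := by
  rw [← Nat.card_Ico]
  have h : ∀ s, truncate c y s ≠ y s → s ∈ active y ∧ c ≤ activeBefore y s := by
    intro s hs
    rw [truncate] at hs
    split_ifs at hs with h
    · simp at hs
    · exact ⟨by simp [active, hs.symm], not_lt.1 h⟩
  refine Finset.card_le_card_of_injOn (activeBefore y) (fun s hs => ?_)
    ((activeBefore_injOn y).mono fun s hs => (h s (Finset.mem_filter.1 hs).2).1)
  have := h s (Finset.mem_filter.1 hs).2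
  simp only [Finset.coe_Ico, Set.mem_Ico]
  exact ⟨this.2, activeBefore_lt_card this.1⟩

end Truncate

/-! ### Exponential moments and tail bounds for pairs and for the excess. -/

/-- There are exactly one candidate and exactly one witness. -/
def HasPair {n : ℕ} (a : Fin n → Role) : Prop :=
  (∃! v, a v = some true) ∧ ∃! w, a w = some false

open Classical in
/-- The number of slots with exactly one candidate and exactly one witness. -/
noncomputable def numPairs {n S : ℕ} (x : Fin n → Fin S → Role) : ℕ :=
  (Finset.univ.filter fun s => HasPair fun v => x v s).card

/-- A pair is lost only in a slot where truncation changes some device, and each device is changed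
in at most as many slots as its excess. -/
theorem numPairs_le_truncate {n S : ℕ} (c : ℕ) (x : Fin n → Fin S → Role) :
    numPairs x ≤ numPairs (fun v => truncate c (x v)) + ∑ v, ((active (x v)).card - c) := by
  classical
  have h : (Finset.univ.filter fun s => HasPair fun v => x v s) ⊆
      (Finset.univ.filter fun s => HasPair fun v => truncate c (x v) s) ∪
      Finset.univ.biUnion fun v => Finset.univ.filter fun s => truncate c (x v) s ≠ x v s := by
    intro s hs
    simp only [Finset.mem_union, Finset.mem_filter, Finset.mem_univ, true_and,
      Finset.mem_biUnion] at hs ⊢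
    by_cases hv : ∃ v, truncate c (x v) s ≠ x v s
    · exact Or.inr hv
    · push Not at hv
      exact Or.inl (by simpa only [hv] using hs)
  refine (Finset.card_le_card h).trans ((Finset.card_union_le _ _).trans ?_)
  refine Nat.add_le_add le_rfl (Finset.card_biUnion_le.trans ?_)
  exact Finset.sum_le_sum fun v _ => card_truncate_ne_le c (x v)

/-- The `- 1` matters: a device with no active slot contributes exactly `1`, so the expectation is
`1` plus a term proportional to the activity rate, and its `n`-th power stays bounded independently
of `n`. -/
theorem two_pow_tsub_le (a c : ℕ) : (2 : ℝ) ^ (a - c) ≤ 1 + (1 / 2) ^ c * (2 ^ a - 1) := by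
  rcases le_total a c with h | h
  · have h1 : (1 : ℝ) ≤ 2 ^ a := one_le_pow₀ (by norm_num)
    have h2 : (0 : ℝ) ≤ (1 / 2) ^ c * (2 ^ a - 1) := mul_nonneg (by positivity) (by linarith)
    rw [Nat.sub_eq_zero_of_le h]
    simpa using h2
  · obtain ⟨d, rfl⟩ := Nat.exists_eq_add_of_le h
    have h1 : ((1 : ℝ) / 2) ^ c ≤ 1 := pow_le_one₀ (by norm_num) (by norm_num)
    have h2 : ((1 : ℝ) / 2) ^ c * 2 ^ (c + d) = 2 ^ d := by
      rw [pow_add, ← mul_assoc, ← mul_pow]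
      norm_num
    rw [Nat.add_sub_cancel_left, mul_sub, h2]
    linarith

theorem sum_prod_roleWeight_mul (k : ℕ) {S : ℕ} (g : Role → ℝ) :
    ∑ y : Fin S → Role, (∏ s, roleWeight k (y s)) * ∏ s, g (y s) =
      (∑ a, roleWeight k a * g a) ^ S := by
  rw [← Fin.prod_const, Fintype.prod_sum]
  exact Finset.sum_congr rfl fun y _ => Finset.prod_mul_distrib.symm

theorem sum_prod_roleWeight (k S : ℕ) : ∑ y : Fin S → Role, ∏ s, roleWeight k (y s) = 1 := by
  have := sum_prod_roleWeight_mul k (S := S) fun _ => 1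
  simp only [mul_one, Finset.prod_const_one, sum_roleWeight, one_pow] at this
  exact this

theorem sum_prod_roleWeight_mul_two_pow (k S : ℕ) :
    ∑ y : Fin S → Role, (∏ s, roleWeight k (y s)) * 2 ^ (active y).card =
      (1 + (1 / 2) ^ k) ^ S := by
  have h : ∀ y : Fin S → Role,
      (2 : ℝ) ^ (active y).card = ∏ s, if y s ≠ none then 2 else 1 := by
    intro y
    rw [Finset.prod_ite, Finset.prod_const_one, mul_one, Finset.prod_const, active]
  simp only [h]
  rw [sum_prod_roleWeight_mul k fun a : Role => if a ≠ none then (2 : ℝ) else 1]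
  congr 1
  simp only [Fintype.sum_option, Fintype.sum_bool, roleWeight]
  simp

theorem sum_tableWeight_mul_two_pow_le (k c n S : ℕ) :
    ∑ x : Fin n → Fin S → Role, tableWeight k x * 2 ^ (∑ v, ((active (x v)).card - c)) ≤
      (1 + (1 / 2) ^ c * ((1 + (1 / 2) ^ k) ^ S - 1)) ^ n := by
  have h : ∑ x : Fin n → Fin S → Role, tableWeight k x * 2 ^ (∑ v, ((active (x v)).card - c)) =
      (∑ y : Fin S → Role, (∏ s, roleWeight k (y s)) * 2 ^ ((active y).card - c)) ^ n := by
    rw [← Fin.prod_const, Fintype.prod_sum]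
    refine Finset.sum_congr rfl fun x _ => ?_
    rw [tableWeight, ← Finset.prod_pow_eq_pow_sum, ← Finset.prod_mul_distrib]
  rw [h]
  have hw : ∀ y : Fin S → Role, 0 ≤ ∏ s, roleWeight k (y s) :=
    fun y => Finset.prod_nonneg fun _ _ => roleWeight_nonneg _ _
  refine pow_le_pow_left₀ (Finset.sum_nonneg fun y _ => mul_nonneg (hw y) (by positivity)) ?_ n
  refine (Finset.sum_le_sum fun y _ =>
    mul_le_mul_of_nonneg_left (two_pow_tsub_le (active y).card c) (hw y)).trans_eq ?_
  have h1 := sum_prod_roleWeight_mul_two_pow k S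
  have h2 := sum_prod_roleWeight k S
  simp only [mul_add, mul_sub, mul_one, Finset.sum_add_distrib, Finset.sum_sub_distrib,
    ← Finset.sum_mul, mul_left_comm _ ((1 / 2 : ℝ) ^ c), ← Finset.mul_sum, h1, h2, one_mul]

/-- The probability that a slot has exactly one candidate and exactly one witness. -/
noncomputable def pairProb (k n : ℕ) : ℝ :=
  open Classical in ∑ a : Fin n → Role with HasPair a, ∏ v, roleWeight k (a v)

/-- Transposing the table makes the slots independent factors; a slot with a pair contributes `1 /
2` and any other contributes `1`. -/
theorem sum_tableWeight_mul_half_pow (k n S : ℕ) :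
    ∑ x : Fin n → Fin S → Role, tableWeight k x * (1 / 2) ^ numPairs x =
      (1 - pairProb k n / 2) ^ S := by
  classical
  have h : 1 - pairProb k n / 2 = ∑ a : Fin n → Role,
      (∏ v, roleWeight k (a v)) * if HasPair a then 1 / 2 else 1 := by
    have h1 := sum_prod_roleWeight k n
    have h2 : ∀ a : Fin n → Role, (∏ v, roleWeight k (a v)) * (if HasPair a then 1 / 2 else 1) =
        (∏ v, roleWeight k (a v)) - (if HasPair a then ∏ v, roleWeight k (a v) else 0) / 2 := by
      intro a
      split_ifs <;> ring
    simp only [h2, Finset.sum_sub_distrib, h1, ← Finset.sum_div, pairProb, Finset.sum_filter]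
  rw [h, ← Fin.prod_const, Fintype.prod_sum]
  refine Fintype.sum_equiv (Equiv.piComm _) _ _ fun x => ?_
  rw [tableWeight, numPairs, Finset.prod_comm, Finset.prod_mul_distrib]
  congr 1
  rw [Finset.prod_ite, Finset.prod_const_one, mul_one, Finset.prod_const]
  rfl

/-- The roles if `p.1` is the only candidate and `p.2` is the only witness. -/
def pairRoles {n : ℕ} (p : Fin n × Fin n) (v : Fin n) : Role :=
  if v = p.1 then some true else if v = p.2 then some false else none

theorem pairProb_ge (k n : ℕ) :
    (n * (n - 1) : ℝ) * (((1 / 2) ^ k / 2) ^ 2 * (1 - (1 / 2) ^ k) ^ (n - 2)) ≤ pairProb k n := by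
  classical
  have hpair : ∀ p ∈ (Finset.univ : Finset (Fin n)).offDiag, HasPair (pairRoles p) := by
    intro p hp
    have hp' : p.1 ≠ p.2 := (Finset.mem_offDiag.1 hp).2.2
    refine ⟨⟨p.1, by simp [pairRoles], fun v hv => ?_⟩,
      ⟨p.2, by simp [pairRoles, hp'.symm], fun v hv => ?_⟩⟩
    · simp only [pairRoles] at hv
      split_ifs at hv with h1 h2 <;> simp_all
    · simp only [pairRoles] at hv
      split_ifs at hv with h1 h2 <;> simp_all
  have hinj : Set.InjOn (pairRoles (n := n)) (Finset.univ : Finset (Fin n)).offDiag := by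
    intro p hp p' hp' h
    have h1 := hpair p hp
    have hq : p'.1 ≠ p'.2 := (Finset.mem_offDiag.1 hp').2.2
    have hr : p.1 ≠ p.2 := (Finset.mem_offDiag.1 hp).2.2
    refine Prod.ext (h1.1.unique (by simp [pairRoles]) ?_) (h1.2.unique ?_ ?_)
    · rw [h]; simp [pairRoles]
    · simp [pairRoles, hr.symm]
    · rw [h]; simp [pairRoles, hq.symm]
  have hweight : ∀ p ∈ (Finset.univ : Finset (Fin n)).offDiag, ∏ v, roleWeight k (pairRoles p v) =
      ((1 / 2) ^ k / 2) ^ 2 * (1 - (1 / 2) ^ k) ^ (n - 2) := by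
    intro p hp
    have hp' : p.1 ≠ p.2 := (Finset.mem_offDiag.1 hp).2.2
    have hs : ({p.1, p.2} : Finset (Fin n)).card = 2 := Finset.card_pair hp'
    rw [← Finset.prod_mul_prod_compl {p.1, p.2}, Finset.prod_pair hp']
    congr 1
    · simp [pairRoles, hp'.symm, roleWeight, sq]
    · rw [Finset.prod_congr rfl (g := fun _ => 1 - ((1 : ℝ) / 2) ^ k), Finset.prod_const,
        Finset.card_compl, hs, Fintype.card_fin]
      intro v hv
      simp only [Finset.mem_compl, Finset.mem_insert, Finset.mem_singleton, not_or] at hv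
      simp [pairRoles, hv.1, hv.2, roleWeight]
  have hcard : (n * (n - 1) : ℝ) = ((Finset.univ : Finset (Fin n)).offDiag.card : ℝ) := by
    rw [Finset.offDiag_card, Finset.card_univ, Fintype.card_fin, Nat.cast_sub (Nat.le_mul_self n)]
    push_cast
    ring
  rw [hcard, ← nsmul_eq_mul, ← Finset.sum_const, ← Finset.sum_congr rfl hweight,
    ← Finset.sum_image (f := fun a => ∏ v, roleWeight k (a v)) hinj, pairProb]
  refine Finset.sum_le_sum_of_subset_of_nonneg ?_
    fun _ _ _ => Finset.prod_nonneg fun _ _ => roleWeight_nonneg _ _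
  intro a ha
  obtain ⟨p, hp, rfl⟩ := Finset.mem_image.1 ha
  exact Finset.mem_filter.2 ⟨Finset.mem_univ _, hpair p hp⟩

/-- The estimate is `(1 - 1 / M) ^ (M - 1) ≥ exp (-1) ≥ 1 / 4`. -/
theorem quarter_le_one_sub_inv_pow {M : ℝ} (hM : 2 ≤ M) {j : ℕ} (hj : (j : ℝ) ≤ M - 1) :
    1 / 4 ≤ (1 - 1 / M) ^ j := by
  have h1 : Real.exp (-(1 / (M - 1))) ≤ 1 - 1 / M := by
    rw [Real.exp_neg]
    have h2 := Real.add_one_le_exp (1 / (M - 1))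
    have h3 : 1 / (M - 1) + 1 = (1 - 1 / M)⁻¹ := by
      have : M - 1 ≠ 0 := by linarith
      have : M ≠ 0 := by linarith
      field_simp
      ring
    rw [h3] at h2
    have h4 : 0 < 1 - 1 / M := by
      rw [sub_pos, div_lt_one (by linarith)]
      linarith
    exact inv_le_of_inv_le₀ h4 h2
  calc (1 : ℝ) / 4 ≤ Real.exp (-1) := by
        rw [Real.exp_neg, ← one_div]
        exact one_div_le_one_div_of_le (Real.exp_pos _) (by linarith [Real.exp_one_lt_d9])
    _ ≤ Real.exp (j * -(1 / (M - 1))) := by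
        rw [Real.exp_le_exp, mul_neg, neg_le_neg_iff, mul_one_div, div_le_one (by linarith)]
        exact hj
    _ = Real.exp (-(1 / (M - 1))) ^ j := Real.exp_nat_mul _ _
    _ ≤ (1 - 1 / M) ^ j := pow_le_pow_left₀ (Real.exp_pos _).le h1 j

theorem pairProb_ge_of_two_le {k n : ℕ} (h2 : 2 ≤ n) (hn : n ≤ 2 ^ k) (hn' : 2 ^ k < 4 * n) :
    1 / 512 ≤ pairProb k n := by
  refine le_trans ?_ (pairProb_ge k n)
  have hM : (2 : ℝ) ≤ 2 ^ k := by exact_mod_cast h2.trans hn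
  have h2' : (2 : ℝ) ≤ n := by exact_mod_cast h2
  have hn1 : (2 : ℝ) ^ k ≤ 4 * n := by exact_mod_cast hn'.le
  have hn2 : (n : ℝ) ≤ 2 ^ k := by exact_mod_cast hn
  rw [one_div_pow]
  generalize (2 : ℝ) ^ k = M at *
  have h3 := quarter_le_one_sub_inv_pow hM (j := n - 2) (by
    rw [Nat.cast_sub h2]
    push_cast
    linarith)
  -- From `n - 1 ≥ n / 2` and `n ≥ M / 4`.
  have h4 : M ^ 2 / 32 ≤ n * (n - 1 : ℝ) := by nlinarith
  have h5 : (1 : ℝ) / 512 = M ^ 2 / 32 * ((1 / M / 2) ^ 2 * (1 / 4)) := by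
    field_simp
    norm_num
  rw [h5]
  have : 0 < M := by linarith
  have : 0 ≤ (n : ℝ) * (n - 1) := mul_nonneg (by linarith) (by linarith)
  gcongr

/-- Markov's inequality for `2 ^ (-numPairs)`: its mean is at most `exp (-16 * l)`, against the
threshold `2 ^ (-8 * l)`. -/
theorem sum_numPairs_le {k n l : ℕ} (hp : 1 / 512 ≤ pairProb k n) :
    ∑ x : Fin n → Fin (16384 * l) → Role with numPairs x ≤ 8 * l, tableWeight k x ≤
      (1 / 4) ^ l := by
  calc ∑ x : Fin n → Fin (16384 * l) → Role with numPairs x ≤ 8 * l, tableWeight k x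
      ≤ ∑ x : Fin n → Fin (16384 * l) → Role,
        2 ^ (8 * l) * (tableWeight k x * (1 / 2) ^ numPairs x) := by
        rw [Finset.sum_filter]
        refine Finset.sum_le_sum fun x _ => ?_
        have hx := tableWeight_nonneg k x
        split_ifs with h
        · have h1 : (1 : ℝ) ≤ 2 ^ (8 * l) * (1 / 2) ^ numPairs x := by
            rw [one_div_pow, mul_one_div, le_div_iff₀ (by positivity), one_mul]
            exact pow_le_pow_right₀ (by norm_num) h
          calc tableWeight k x ≤ tableWeight k x * (2 ^ (8 * l) * (1 / 2) ^ numPairs x) :=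
                le_mul_of_one_le_right hx h1
            _ = _ := by ring
        · positivity
    _ = 2 ^ (8 * l) * (1 - pairProb k n / 2) ^ (16384 * l) := by
        rw [← Finset.mul_sum, sum_tableWeight_mul_half_pow]
    _ ≤ 2 ^ (8 * l) * Real.exp (-(1 / 1024)) ^ (16384 * l) := by
        have h0 : 0 ≤ 1 - pairProb k n / 2 := by
          have h1 : pairProb k n ≤ 1 := by
            rw [← sum_prod_roleWeight k n]
            exact Finset.sum_le_sum_of_subset_of_nonneg (Finset.subset_univ _)
              fun _ _ _ => Finset.prod_nonneg fun _ _ => roleWeight_nonneg _ _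
          linarith
        gcongr
        have := Real.add_one_le_exp (-(1 / 1024))
        linarith
    _ ≤ (1 / 4) ^ l := by
        rw [pow_mul, pow_mul, ← mul_pow, ← Real.exp_nat_mul]
        refine pow_le_pow_left₀ (by positivity) ?_ l
        have h1 : ((16384 : ℕ) : ℝ) * -(1 / 1024) = ((16 : ℕ) : ℝ) * (-1) := by norm_num
        rw [h1, Real.exp_nat_mul, Real.exp_neg]
        have h2 : (Real.exp 1)⁻¹ ≤ 2⁻¹ := inv_anti₀ (by norm_num) (by linarith [Real.exp_one_gt_d9])
        calc (2 : ℝ) ^ 8 * (Real.exp 1)⁻¹ ^ 16 ≤ 2 ^ 8 * 2⁻¹ ^ 16 := by gcongr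
          _ ≤ 1 / 4 := by norm_num

theorem one_add_pow_sub_one_le {q : ℝ} (hq : 0 ≤ q) (S : ℕ) :
    (1 + q) ^ S - 1 ≤ S * q * Real.exp (S * q) := by
  have h1 : (1 + q) ^ S ≤ Real.exp (S * q) := by
    rw [Real.exp_nat_mul]
    exact pow_le_pow_left₀ (by linarith) (by linarith [Real.add_one_le_exp q]) S
  have h2 := Real.add_one_le_exp (-(S * q))
  have h3 : Real.exp (-(S * q)) * Real.exp (S * q) = 1 := by
    rw [← Real.exp_add]
    simp
  nlinarith [Real.exp_pos (S * q)]

/-- Markov's inequality for `2` to the total excess: the mean is at most `e ^ l`, against the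
threshold `16 ^ l`. -/
theorem sum_excess_le {k n l c : ℕ} (hn : n ≤ 2 ^ k)
    (hc : 16 + 2 * (16384 * l / 2 ^ k) ≤ c) :
    ∑ x : Fin n → Fin (16384 * l) → Role with 4 * l ≤ ∑ v, ((active (x v)).card - c),
      tableWeight k x ≤ (1 / 4) ^ l := by
  have hk : (0 : ℝ) < 2 ^ k := by positivity
  have hq : (0 : ℝ) ≤ (1 / 2) ^ k := by positivity
  set S := 16384 * l with hS
  set d := S / 2 ^ k + 1 with hd
  have hSq : (S : ℝ) * (1 / 2) ^ k ≤ d := by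
    rw [one_div_pow, mul_one_div, div_le_iff₀ hk]
    have := (Nat.lt_div_mul_add (a := S) (b := 2 ^ k) (by positivity)).le
    have h2 : S ≤ d * 2 ^ k := by rw [hd, add_mul, one_mul]; exact this
    exact_mod_cast h2
  -- Here `c ≥ 14 + 2 * d`; the part `2 * d` absorbs `e ^ d ≤ 4 ^ d`, and the remaining `2⁻¹⁴`
  -- cancels the factor `16384` in `S`.
  have hexp : ((1 : ℝ) / 2) ^ c * Real.exp (S * (1 / 2) ^ k) ≤ (1 / 2) ^ 14 := by
    calc ((1 : ℝ) / 2) ^ c * Real.exp (S * (1 / 2) ^ k)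
        ≤ (1 / 2) ^ (14 + 2 * d) * Real.exp (d * 1) := by
          gcongr ?_ * ?_
          · exact pow_le_pow_of_le_one (by norm_num) (by norm_num) (by omega)
          · rw [mul_one]
            exact Real.exp_le_exp.2 hSq
      _ ≤ (1 / 2) ^ (14 + 2 * d) * 4 ^ d := by
          rw [Real.exp_nat_mul]
          gcongr
          linarith [Real.exp_one_lt_d9]
      _ = (1 / 2) ^ 14 := by
          rw [pow_add, pow_mul, mul_assoc, ← mul_pow]
          norm_num
  have hmain : (1 + ((1 : ℝ) / 2) ^ c * ((1 + (1 / 2) ^ k) ^ S - 1)) ^ n ≤ Real.exp 1 ^ l := by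
    have h0 : 0 ≤ (1 + (1 / 2 : ℝ) ^ k) ^ S - 1 :=
      sub_nonneg.2 (one_le_pow₀ (by linarith))
    have h1 : ((1 : ℝ) / 2) ^ c * ((1 + (1 / 2) ^ k) ^ S - 1) ≤ l * (1 / 2) ^ k := by
      calc ((1 : ℝ) / 2) ^ c * ((1 + (1 / 2) ^ k) ^ S - 1)
          ≤ (1 / 2) ^ c * (S * (1 / 2) ^ k * Real.exp (S * (1 / 2) ^ k)) := by
            gcongr
            exact one_add_pow_sub_one_le hq S
        _ = (1 / 2) ^ c * Real.exp (S * (1 / 2) ^ k) * (S * (1 / 2) ^ k) := by ring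
        _ ≤ (1 / 2) ^ 14 * (S * (1 / 2) ^ k) := by gcongr
        _ = l * (1 / 2) ^ k := by
            rw [hS]
            push_cast
            ring
    calc (1 + ((1 : ℝ) / 2) ^ c * ((1 + (1 / 2) ^ k) ^ S - 1)) ^ n
        ≤ Real.exp (l * (1 / 2) ^ k) ^ n := by
          refine pow_le_pow_left₀ (by positivity) ?_ n
          linarith [Real.add_one_le_exp ((l : ℝ) * (1 / 2) ^ k)]
      _ = Real.exp (n * (l * (1 / 2) ^ k)) := (Real.exp_nat_mul _ _).symm
      _ ≤ Real.exp (l * 1) := by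
          rw [Real.exp_le_exp]
          have hn2 : (n : ℝ) * (1 / 2) ^ k ≤ 1 := by
            rw [one_div_pow, mul_one_div, div_le_one hk]
            exact_mod_cast hn
          calc (n : ℝ) * (l * (1 / 2) ^ k) = l * (n * (1 / 2) ^ k) := by ring
            _ ≤ l * 1 := by gcongr
      _ = Real.exp 1 ^ l := Real.exp_nat_mul _ _
  calc ∑ x : Fin n → Fin S → Role with 4 * l ≤ ∑ v, ((active (x v)).card - c), tableWeight k x
      ≤ ∑ x : Fin n → Fin S → Role,
        (1 / 2) ^ (4 * l) * (tableWeight k x * 2 ^ ∑ v, ((active (x v)).card - c)) := by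
        rw [Finset.sum_filter]
        refine Finset.sum_le_sum fun x _ => ?_
        have hx := tableWeight_nonneg k x
        split_ifs with h
        · have h1 : (1 : ℝ) ≤ (1 / 2) ^ (4 * l) * 2 ^ ∑ v, ((active (x v)).card - c) := by
            rw [one_div_pow, one_div_mul_eq_div, le_div_iff₀ (by positivity), one_mul]
            exact pow_le_pow_right₀ (by norm_num) h
          calc tableWeight k x ≤ tableWeight k x *
                ((1 / 2) ^ (4 * l) * 2 ^ ∑ v, ((active (x v)).card - c)) :=
                le_mul_of_one_le_right hx h1
            _ = _ := by ring
        · positivity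
    _ ≤ (1 / 2) ^ (4 * l) * Real.exp 1 ^ l := by
        rw [← Finset.mul_sum]
        gcongr
        exact (sum_tableWeight_mul_two_pow_le k c n S).trans hmain
    _ ≤ (1 / 4) ^ l := by
        rw [pow_mul, ← mul_pow]
        refine pow_le_pow_left₀ (by positivity) ?_ l
        linarith [Real.exp_one_lt_d9]

/-! ### The algorithm and its guarantees. -/

/-- The roles that a device reads off its bits, with at most `c` active slots. -/
def truncatedRoles (k S c : ℕ) (ω : Tape) : Fin S → Role := truncate c (rawRoles k S ω)

theorem measurable_truncatedRoles (k S c : ℕ) : Measurable (truncatedRoles k S c) :=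
  (Measurable.of_discrete (f := truncate c)).comp (measurable_rawRoles k S)

/-- The leader election algorithm. -/
def leaderElection (k l c : ℕ) : Algorithm :=
  relay 4096 (16384 * l) (truncatedRoles k (16384 * l) c) (measurable_truncatedRoles k _ c)

open Classical in
theorem card_chosen_eq_numPairs {S n : ℕ} (ρ : Tape → Fin S → Role) (ω : Fin n → Tape) :
    ((Finset.range S).filter fun s => ∃ v, Chosen (roles ρ ω) s v).card =
      numPairs fun v => ρ (ω v) := by
  rw [numPairs, Finset.card_filter, Finset.card_filter, Finset.sum_range]
  refine Finset.sum_congr rfl fun s _ => ?_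
  have h : (∃ v, Chosen (roles ρ ω) s v) ↔ HasPair fun v => ρ (ω v) s := by
    have hr : ∀ v, roles ρ ω v s = ρ (ω v) s := by
      intro v
      simp [roles, roleAt]
    simp only [Chosen, HasPair, hr, ExistsUnique]
    tauto
  simp only [h]

theorem leaderElection_failure_le {k n l c : ℕ} (hl : 1 ≤ l) (h2 : 2 ≤ n) (hn : n ≤ 2 ^ k)
    (hn' : 2 ^ k < 4 * n) (hc : 16 + 2 * (16384 * l / 2 ^ k) ≤ c) :
    networkLaw n {ω | ¬ ∃ v, (leaderElection k l c).IsLeader ω (4 * (16384 * l)) v} ≤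
      ENNReal.ofReal ((1 / 2) ^ l) := by
  classical
  have hsub : {ω : Fin n → Tape | ¬ ∃ v, (leaderElection k l c).IsLeader ω (4 * (16384 * l)) v} ⊆
      {ω | (fun v => rawRoles k (16384 * l) (ω v)) ∈
        (Finset.univ.filter fun x : Fin n → Fin (16384 * l) → Role => numPairs x ≤ 8 * l) ∪
        Finset.univ.filter fun x => 4 * l ≤ ∑ v, ((active (x v)).card - c)} := by
    intro ω hω
    have h1 := mt (exists_relay_isLeader (B := 4096)
      (hρ := measurable_truncatedRoles k (16384 * l) c) ω) hω
    rw [card_chosen_eq_numPairs] at h1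
    have h3 := numPairs_le_truncate c fun v => rawRoles k (16384 * l) (ω v)
    simp only [Finset.mem_union, Finset.mem_filter, Finset.mem_univ, true_and, Set.mem_ofPred_eq]
    change ¬ 16384 * l < 4096 *
      numPairs (fun v => truncate c (rawRoles k (16384 * l) (ω v))) at h1
    -- If there are more than `8 * l` pairs and the excess is below `4 * l`, then at least `4 * l +
    -- 1` pairs survive, and `4096 * (4 * l + 1)` exceeds `16384 * l`.
    omega
  refine (measure_mono hsub).trans ((networkLaw_rawRoles_mem_le k _).trans
    (ENNReal.ofReal_le_ofReal ?_))
  calc _ ≤ (∑ x : Fin n → Fin (16384 * l) → Role with numPairs x ≤ 8 * l, tableWeight k x) +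
        ∑ x : Fin n → Fin (16384 * l) → Role with 4 * l ≤ ∑ v, ((active (x v)).card - c),
          tableWeight k x := by
        rw [← Finset.sum_union_inter]
        exact le_add_of_nonneg_right (Finset.sum_nonneg fun _ _ => tableWeight_nonneg _ _)
    _ ≤ (1 / 4) ^ l + (1 / 4) ^ l :=
        add_le_add (sum_numPairs_le (pairProb_ge_of_two_le h2 hn hn')) (sum_excess_le hn hc)
    _ = 2 * (1 / 2) ^ l * (1 / 2) ^ l := by
        rw [mul_assoc, ← mul_pow, two_mul]
        norm_num
    _ ≤ 1 * (1 / 2) ^ l := by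
        gcongr
        have := pow_le_pow_of_le_one (a := (1 / 2 : ℝ)) (by norm_num) (by norm_num) hl
        linarith
    _ = (1 / 2) ^ l := one_mul _

theorem leaderElection_energy_le (k l c : ℕ) {n : ℕ} (ω : Fin n → Tape) (v : Fin n) :
    (leaderElection k l c).energy ω (4 * (16384 * l)) v ≤
      16388 * (active (truncate c (rawRoles k (16384 * l) (ω v)))).card :=
  relay_energy_le (B := 4096) (hρ := measurable_truncatedRoles k (16384 * l) c) ω v

theorem leaderElection_expected_energy_le (k l c : ℕ) {n : ℕ} (v : Fin n) :
    ∫⁻ ω, ((leaderElection k l c).energy ω (4 * (16384 * l)) v : ENNReal) ∂(networkLaw n) ≤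
      ENNReal.ofReal (16388 * (16384 * l * (1 / 2) ^ k)) := by
  calc _ ≤ ∫⁻ ω, 16388 * ((active (rawRoles k (16384 * l) (ω v))).card : ENNReal)
        ∂(networkLaw n) := by
        refine lintegral_mono fun ω => ?_
        have h := (leaderElection_energy_le k l c ω v).trans (Nat.mul_le_mul_left 16388
          (Finset.card_le_card (active_truncate_subset c (rawRoles k (16384 * l) (ω v)))))
        refine (Nat.cast_le (α := ENNReal).2 h).trans_eq ?_
        rw [Nat.cast_mul, Nat.cast_ofNat]
    _ = 16388 * ENNReal.ofReal ((16384 * l : ℕ) * (1 / 2) ^ k) := by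
        rw [lintegral_const_mul' _ _ (by simp), ← lintegral_card_active k (16384 * l) v]
        rfl
    _ = _ := by
        rw [ENNReal.ofReal_mul (by norm_num)]
        push_cast
        norm_num

end MultipleAccess

open MultipleAccess in
theorem mainTheorem4 :
    ∃ C : ℝ, 0 < C ∧
      ∀ f : ℝ, 0 < f → f < 1 → ∀ N : ℕ, 2 ≤ N →
        ∃ (A : Algorithm) (T : ℕ),
          (T : ℝ) ≤ C * max 1 (Real.logb 2 (1 / f)) ∧
          ∀ n : ℕ,
            -- fixed running time: every device stops after exactly `T` rounds
            (∀ (ω : Fin n → Tape) (v : Fin n) (t : ℕ), A.HaltedAt ω t v ↔ T ≤ t) ∧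
            -- expected energy
            (∀ v : Fin n,
              ∫⁻ ω, (A.energy ω T v : ENNReal) ∂(networkLaw n) ≤
                ENNReal.ofReal (C * (max 1 (Real.logb 2 (1 / f)) / N))) ∧
            -- worst-case energy
            (∀ (ω : Fin n → Tape) (v : Fin n),
              (A.energy ω T v : ℝ) ≤ C * (1 + Real.logb 2 (1 / f) / N)) ∧
            -- at most one leader, always
            (∀ (ω : Fin n → Tape) (v w : Fin n),
              A.IsLeader ω T v → A.IsLeader ω T w → v = w) ∧
            -- small failure probability if the estimate is correct
            ((N : ℝ) / 2 < n → n ≤ N →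
              networkLaw n {ω | ¬ ∃ v : Fin n, A.IsLeader ω T v} ≤ ENNReal.ofReal f) := by
  -- The factor `16388 = 4 + 4 * 4096` is the energy per active slot; `70000` leaves room for `16 +
  -- 65536` from the bound on `c`.
  refine ⟨16388 * 70000, by norm_num, fun f hf0 hf1 N hN => ?_⟩
  have hlog : 0 ≤ Real.logb 2 (1 / f) :=
    Real.logb_nonneg (by norm_num) ((one_le_div hf0).2 hf1.le)
  have hf : (2 : ℝ) ^ Real.logb 2 (1 / f) = 1 / f :=
    Real.rpow_logb (by norm_num) (by norm_num) (by positivity)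
  set x := Real.logb 2 (1 / f) with hx
  set k := Nat.clog 2 N with hk
  have hk1 : N ≤ 2 ^ k := Nat.le_pow_clog (by norm_num) N
  have hk2 : 2 ^ k < 2 * N := by
    have h1 := Nat.pow_pred_clog_lt_self (b := 2) (by norm_num) (x := N) (by omega)
    have h2 : 0 < k := Nat.clog_pos (by norm_num) hN
    rw [← hk] at h1
    have h3 : k = k.pred + 1 := (Nat.succ_pred_eq_of_pos h2).symm
    rw [h3, pow_succ]
    omega
  set l := ⌈max 1 x⌉₊ with hl
  have hl0 : max 1 x ≤ l := Nat.le_ceil _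
  have hl1 : 1 ≤ l := by
    have : (1 : ℝ) ≤ l := (le_max_left _ _).trans hl0
    exact_mod_cast this
  have hl2 : (l : ℝ) ≤ 2 * max 1 x := by
    have h1 := Nat.ceil_lt_add_one (a := max 1 x) (by positivity)
    have h2 := le_max_left 1 x
    linarith
  have hN0 : (2 : ℝ) ≤ N := by exact_mod_cast hN
  have hq : ((1 : ℝ) / 2) ^ k ≤ 1 / N := by
    rw [one_div_pow]
    exact one_div_le_one_div_of_le (by linarith) (by exact_mod_cast hk1)
  set c := 16 + 2 * (16384 * l / 2 ^ k) with hc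
  refine ⟨leaderElection k l c, 4 * (16384 * l), ?_, fun n => ⟨?_, ?_, ?_, ?_, ?_⟩⟩
  · push_cast
    have := le_max_left 1 x
    linarith
  · exact fun ω v t => relay_haltedAt ω v t
  · intro v
    refine (leaderElection_expected_energy_le k l c v).trans (ENNReal.ofReal_le_ofReal ?_)
    have hm : 0 < max 1 x := lt_of_lt_of_le one_pos (le_max_left _ _)
    calc (16388 : ℝ) * (16384 * l * (1 / 2) ^ k) ≤
          16388 * (16384 * (2 * max 1 x) * (1 / N)) := by gcongr
      _ = 16388 * 32768 * (max 1 x / N) := by ring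
      _ ≤ 16388 * 70000 * (max 1 x / N) := by gcongr; norm_num
  · intro ω v
    have h1 := (leaderElection_energy_le k l c ω v).trans
      (Nat.mul_le_mul_left _ (card_active_truncate_le c (rawRoles k (16384 * l) (ω v))))
    have h2 : ((leaderElection k l c).energy ω (4 * (16384 * l)) v : ℝ) ≤ 16388 * c := by
      exact_mod_cast h1
    have h3 : ((16384 * l / 2 ^ k : ℕ) : ℝ) ≤ 16384 * l * (1 / 2) ^ k := by
      refine Nat.cast_div_le.trans_eq ?_
      push_cast
      rw [one_div_pow, mul_one_div]
    have h4 : (c : ℝ) ≤ 16 + 65536 * (max 1 x / N) := by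
      rw [hc]
      push_cast
      calc (16 : ℝ) + 2 * ((16384 * l / 2 ^ k : ℕ) : ℝ)
          ≤ 16 + 2 * (16384 * (2 * max 1 x) * (1 / N)) := by
            gcongr
            refine h3.trans ?_
            gcongr
        _ = _ := by ring
    -- After multiplication by `N` this is `max 1 x ≤ N + x`. The additive `1` of the worst-case
    -- bound thus absorbs the case of `f` above `1 / 2`.
    have h5 : max 1 x / N ≤ 1 + x / N := by
      rw [div_le_iff₀ (by linarith), add_mul, div_mul_cancel₀ _ (by linarith)]
      exact max_le (by linarith) (by linarith)
    have h6 : 0 ≤ x / N := by positivity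
    linarith
  · exact fun ω v w hv hw => relay_isLeader_unique ω hv hw
  · intro hn1 hn2
    have hn1' : N < 2 * n := by
      have : (N : ℝ) < 2 * n := by linarith
      exact_mod_cast this
    -- The hypotheses give `n ≤ N ≤ 2 ^ k < 2 * N < 4 * n`, and `n ≥ 2` because `2 * n > N ≥ 2`.
    refine (leaderElection_failure_le hl1 (by omega) (hn2.trans hk1) (by omega) le_rfl).trans
      (ENNReal.ofReal_le_ofReal ?_)
    have h1 : (2 : ℝ) ^ x ≤ 2 ^ (l : ℝ) :=
      Real.rpow_le_rpow_of_exponent_le (by norm_num) ((le_max_right _ _).trans hl0)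
    rw [hf, Real.rpow_natCast] at h1
    rw [one_div_pow]
    exact (one_div_le hf0 (by positivity)).1 h1
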